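/- Let $\mathcal A$ be an abelian category with enough projectives and let $F:\mathcal A^{op}\to\mathbf{Ab}$ be an additive (contravariant) functor. Let $R_nF$ ($n\ge 0$) be its right derived functors: $R_nF(X)=H^n(F(P_\bullet))$ for a projective resolution $P_\bullet\to X$. Let $\rho_F:F\to R_0F$ be the canonical natural transformation and let $\overline F=\ker\rho_F$ be the sub-stabilization of $F$, which vanishes on projectives. For each object $X$ choose a short exact sequence $0\to\Omega X\xrightarrow{m}P(X)\xrightarrow{\pi}X\to 0$ with $P(X)$ projective, and put $\Omega^0X=X$, $\Omega^{n+1}X=\Omega(\Omega^nX)$; these sequences splice to a projective resolution of $X$ with $P_n=P(\Omega^nX)$. Then $\overline F\circ\Omega^n$ is a well-defined functor. Let $S^1F(X)=\operatorname{coker}\big(F(m):F(P(X))\to F(\Omega X)\big)$ be the first right satellite and let $S^nF$ be the $n$-fold iterated satellite ($S^0F=F$); by dimension shift $S^{n+1}F\cong S^1F\circ\Omega^n$. The right fundamental sequence of $F$ is the sequence of functors $$0\to\overline F\to F\xrightarrow{\rho_F}R_0F\xrightarrow{\beta_F}\overline F\circ\Omega\to S^1F\to R_1F\to\overline F\circ\Omega^2\to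 S^2F\to R_2F\to\overline F\circ\Omega^3\to\cdots$$ in which, for $n\ge 0$: $R_nF(X)\to\overline F(\Omega^{n+1}X)$ (which is $\beta_F$ for $n=0$) is induced by $F(P_n)\to F(\Omega^{n+1}X)$; $\overline F(\Omega^{n+1}X)\to S^{n+1}F(X)\cong S^1F(\Omega^nX)$ is the composition of the inclusion into $F(\Omega^{n+1}X)$ with the projection onto $S^1F(\Omega^nX)$; and $S^{n+1}F(X)\cong S^1F(\Omega^nX)\to R_{n+1}F(X)$ is induced by $F(\Omega^{n+1}X)\to F(P_{n+1})$. Then: 1. The right fundamental sequence is a complex of functors whose homology is zero except, possibly, at the terms $R_nF$, $n\ge0$. 2. If $F$ is half-exact (i.e. $F(X_3)\to F(X_2)\to F(X_1)$ is exact for every short exact sequence $0\to X_1\to X_2\to X_3\to0$), then the sequence is exact. 3. If $F$ carries monomorphisms to epimorphisms, then $\beta_F$ is an epimorphism. 4. If $F$ carries epimorphisms to monomorphisms, then $\overline F=0$ and $\rho_F$ is a monomorphism. 5. $\rho_F$ is an isomorphism if and only if $F$ is left-exact (i.e. $0\to F(X_3)\to F(X_2)\to F(X_1)$ is exact for every exact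 sequence $X_1\to X_2\to X_3\to0$). -/

import Mathlib

open CategoryTheory Category Limits Opposite

universe w v u

set_option linter.unusedSectionVars false

namespace FundamentalSequence

noncomputable section

section Syzygies

variable {A : Type u} [Category.{v} A] [Abelian A] [EnoughProjectives A]

/-- The syzygy object `Ω X`: the kernel of the chosen epimorphism
`Projective.π X : Projective.over X ⟶ X` from a projective object. -/
def syzygy (X : A) : A := kernel (Projective.π X)

/-- The inclusion of `Ω X` in the chosen projective over `X`. -/
def syzι (X : A) : syzygy X ⟶ Projective.over X := kernel.ι (Projective.π X)

@[simp]
lemma syzι_π (X : A) : syzι X ≫ Projective.π X = 0 := kernel.condition _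

@[simp]
lemma syzι_π_assoc {X Z : A} (h : X ⟶ Z) : syzι X ≫ Projective.π X ≫ h = 0 := by
  rw [← assoc, syzι_π, zero_comp]

instance (X : A) : Mono (syzι X) := inferInstanceAs (Mono (kernel.ι _))

/-- The universal property of `Ω X` as a kernel. -/
def syzLift {X Z : A} (f : Z ⟶ Projective.over X) (h : f ≫ Projective.π X = 0) : Z ⟶ syzygy X :=
  kernel.lift _ f h

@[simp]
lemma syzLift_ι {X Z : A} (f : Z ⟶ Projective.over X) (h : f ≫ Projective.π X = 0) :
    syzLift f h ≫ syzι X = f := kernel.lift_ι _ _ _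

/-- A chosen lift of `f : X ⟶ Y` to the projectives over `X` and `Y`. -/
def overMap {X Y : A} (f : X ⟶ Y) : Projective.over X ⟶ Projective.over Y :=
  Projective.factorThru (Projective.π X ≫ f) (Projective.π Y)

@[simp]
lemma overMap_π {X Y : A} (f : X ⟶ Y) :
    overMap f ≫ Projective.π Y = Projective.π X ≫ f :=
  Projective.factorThru_comp _ _

@[simp]
lemma overMap_π_assoc {X Y Z : A} (f : X ⟶ Y) (h : Y ⟶ Z) :
    overMap f ≫ Projective.π Y ≫ h = Projective.π X ≫ f ≫ h := by
  rw [← assoc, overMap_π, assoc]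

/-- The map `Ω f : Ω X ⟶ Ω Y` induced by the chosen lift of `f`. It depends on this choice
only up to maps that factor through a projective. -/
def syzygyMap {X Y : A} (f : X ⟶ Y) : syzygy X ⟶ syzygy Y :=
  syzLift (syzι X ≫ overMap f) (by simp)

@[simp]
lemma syzygyMap_ι {X Y : A} (f : X ⟶ Y) : syzygyMap f ≫ syzι Y = syzι X ≫ overMap f :=
  syzLift_ι _ _

@[simp]
lemma syzygyMap_ι_assoc {X Y Z : A} (f : X ⟶ Y) (h : Projective.over Y ⟶ Z) :
    syzygyMap f ≫ syzι Y ≫ h = syzι X ≫ overMap f ≫ h := by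
  rw [← assoc, syzygyMap_ι, assoc]

/-- Two parallel morphisms are stably equal if their difference factors through a projective. -/
def StablyEq {X Y : A} (f g : X ⟶ Y) : Prop :=
  ∃ (P : A) (_ : Projective P) (a : X ⟶ P) (b : P ⟶ Y), f - g = a ≫ b

lemma StablyEq.refl {X Y : A} (f : X ⟶ Y) : StablyEq f f :=
  ⟨Projective.over X, inferInstance, 0, 0, by simp⟩

/-- Maps of syzygies induced by stably equal maps differ by a map that extends
to the projective. -/
lemma exists_factor_of_lifts {X Y : A} {f g : X ⟶ Y} (h : StablyEq f g)
    {u v : syzygy X ⟶ syzygy Y} {p q : Projective.over X ⟶ Projective.over Y}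
    (hp : p ≫ Projective.π _ = Projective.π _ ≫ f)
    (hq : q ≫ Projective.π _ = Projective.π _ ≫ g)
    (hu : u ≫ syzι Y = syzι X ≫ p) (hv : v ≫ syzι Y = syzι X ≫ q) :
    ∃ k : Projective.over X ⟶ syzygy Y, u - v = syzι X ≫ k := by
  obtain ⟨P, _, a, b, hab⟩ := h
  let b' : P ⟶ Projective.over Y := Projective.factorThru b (Projective.π _)
  have hb' : b' ≫ Projective.π _ = b := by simp [b']
  have h0 : (p - q - Projective.π _ ≫ a ≫ b') ≫ Projective.π Y = 0 := by
    simp only [Preadditive.sub_comp, hp, hq, assoc, hb', ← hab, Preadditive.comp_sub, sub_self]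
  refine ⟨syzLift _ h0, ?_⟩
  rw [← cancel_mono (syzι Y)]
  simp only [Preadditive.sub_comp, assoc, hu, hv, syzLift_ι, Preadditive.comp_sub, syzι_π_assoc,
    sub_zero]

lemma stablyEq_of_lifts {X Y : A} {f g : X ⟶ Y} (h : StablyEq f g)
    {u v : syzygy X ⟶ syzygy Y} {p q : Projective.over X ⟶ Projective.over Y}
    (hp : p ≫ Projective.π _ = Projective.π _ ≫ f)
    (hq : q ≫ Projective.π _ = Projective.π _ ≫ g)
    (hu : u ≫ syzι Y = syzι X ≫ p) (hv : v ≫ syzι Y = syzι X ≫ q) :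
    StablyEq u v := by
  obtain ⟨k, hk⟩ := exists_factor_of_lifts h hp hq hu hv
  exact ⟨_, inferInstance, _, _, hk⟩

lemma syzygyMap_id (X : A) :
    ∃ k, syzygyMap (𝟙 X) - 𝟙 (syzygy X) = syzι X ≫ k :=
  exists_factor_of_lifts (StablyEq.refl (𝟙 X)) (overMap_π _) (q := 𝟙 _) (by simp) (by simp)
    (by simp)

lemma syzygyMap_comp {X Y Z : A} (f : X ⟶ Y) (g : Y ⟶ Z) :
    ∃ k, syzygyMap (f ≫ g) - syzygyMap f ≫ syzygyMap g = syzι X ≫ k :=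
  exists_factor_of_lifts (StablyEq.refl (f ≫ g)) (overMap_π _) (q := overMap f ≫ overMap g)
    (by simp) (by simp) (by simp)

lemma syzygyMap_add {X Y : A} (f g : X ⟶ Y) :
    ∃ k, syzygyMap (f + g) - (syzygyMap f + syzygyMap g) = syzι X ≫ k :=
  exists_factor_of_lifts (StablyEq.refl (f + g)) (overMap_π _) (q := overMap f + overMap g)
    (by simp) (by simp) (by simp)

/-- The iterated syzygy object `Ωⁿ X`. -/
def syz : ℕ → A → A
  | 0, X => X
  | n + 1, X => syzygy (syz n X)

/-- The map `Ωⁿ f : Ωⁿ X ⟶ Ωⁿ Y` given by the chosen lifts. -/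
def syzMap {X Y : A} : ∀ (n : ℕ) (_ : X ⟶ Y), (syz n X ⟶ syz n Y)
  | 0, f => f
  | n + 1, f => syzygyMap (syzMap n f)

lemma syzMap_id (n : ℕ) (X : A) : StablyEq (syzMap n (𝟙 X)) (𝟙 (syz n X)) := by
  induction n with
  | zero => exact StablyEq.refl _
  | succ n ih =>
    exact stablyEq_of_lifts ih (overMap_π _) (q := 𝟙 _) (by simp) (syzygyMap_ι _) (by
      rw [comp_id]; exact id_comp _)

lemma syzMap_comp (n : ℕ) {X Y Z : A} (f : X ⟶ Y) (g : Y ⟶ Z) :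
    StablyEq (syzMap n (f ≫ g)) (syzMap n f ≫ syzMap n g) := by
  induction n with
  | zero => exact StablyEq.refl _
  | succ n ih =>
    exact stablyEq_of_lifts ih (overMap_π _) (q := overMap (syzMap n f) ≫ overMap (syzMap n g))
      (by simp) (syzygyMap_ι _)
      (v := syzygyMap (syzMap n f) ≫ syzygyMap (syzMap n g)) (by simp)

end Syzygies

section Functors

variable {A : Type u} [Category.{v} A] [Abelian A] [EnoughProjectives A]

/-- A contravariant functor that vanishes on projectives. -/
class VanishesOnProjectives (G : Aᵒᵖ ⥤ AddCommGrpCat.{w}) : Prop where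
  isZero (P : A) [Projective P] : IsZero (G.obj (op P))

lemma map_eq_of_stablyEq (G : Aᵒᵖ ⥤ AddCommGrpCat.{w}) [G.Additive] [VanishesOnProjectives G]
    {X Y : A} {f g : X ⟶ Y} (h : StablyEq f g) : G.map f.op = G.map g.op := by
  obtain ⟨P, _, a, b, hab⟩ := h
  rw [← sub_eq_zero, ← G.map_sub, ← op_sub, hab, op_comp, G.map_comp,
    (VanishesOnProjectives.isZero (G := G) P).eq_of_tgt (G.map b.op) 0, zero_comp]

/-- The functor `G ∘ Ωⁿ` for an additive contravariant functor `G` that vanishes on projectives. -/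
def compSyz (G : Aᵒᵖ ⥤ AddCommGrpCat.{w}) [G.Additive] [VanishesOnProjectives G] (n : ℕ) :
    Aᵒᵖ ⥤ AddCommGrpCat.{w} where
  obj X := G.obj (op (syz n X.unop))
  map f := G.map (syzMap n f.unop).op
  map_id X := by
    rw [← G.map_id]
    exact map_eq_of_stablyEq G (syzMap_id n X.unop)
  map_comp f g := by
    rw [← G.map_comp]
    exact map_eq_of_stablyEq G (syzMap_comp n g.unop f.unop)

/-- The map `F(P) ⟶ F(ΩX)` induced by the inclusion of `ΩX` in the chosen projective `P`
over `X`. -/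
def restr (F : Aᵒᵖ ⥤ AddCommGrpCat.{w}) (X : A) :
    F.obj (op (Projective.over X)) ⟶ F.obj (op (syzygy X)) :=
  F.map (syzι X).op

lemma restr_naturality (F : Aᵒᵖ ⥤ AddCommGrpCat.{w}) {X Y : A} (f : X ⟶ Y) :
    restr F Y ≫ F.map (syzygyMap f).op = F.map (overMap f).op ≫ restr F X := by
  simp only [restr, ← F.map_comp, ← op_comp, syzygyMap_ι]

lemma map_comp_cokernel_eq (F : Aᵒᵖ ⥤ AddCommGrpCat.{w}) [F.Additive] {X Y : A}
    {u v : syzygy X ⟶ syzygy Y} (h : ∃ k, u - v = syzι X ≫ k) :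
    F.map u.op ≫ cokernel.π (restr F X) = F.map v.op ≫ cokernel.π (restr F X) := by
  obtain ⟨k, hk⟩ := h
  have : F.map u.op - F.map v.op = F.map k.op ≫ restr F X := by
    rw [restr, ← F.map_sub, ← op_sub, hk, op_comp, F.map_comp]
  rw [← sub_eq_zero, ← Preadditive.sub_comp, this, assoc, cokernel.condition, comp_zero]

/-- The first right satellite `S¹F` of an additive contravariant functor:
`S¹F(X)` is the cokernel of `F(P) ⟶ F(ΩX)`, where `0 ⟶ ΩX ⟶ P ⟶ X ⟶ 0` is the chosen
syzygy sequence. -/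
def satellite (F : Aᵒᵖ ⥤ AddCommGrpCat.{w}) [F.Additive] : Aᵒᵖ ⥤ AddCommGrpCat.{w} where
  obj X := cokernel (restr F X.unop)
  map {X Y} f := cokernel.map (restr F X.unop) (restr F Y.unop)
    (F.map (overMap f.unop).op) (F.map (syzygyMap f.unop).op) (restr_naturality F f.unop)
  map_id X := by
    rw [← cancel_epi (cokernel.π _), cokernel.π_desc, comp_id]
    exact (map_comp_cokernel_eq F (syzygyMap_id X.unop)).trans (by simp)
  map_comp {X Y Z} f g := by
    rw [← cancel_epi (cokernel.π _), cokernel.π_desc, cokernel.π_desc_assoc, assoc,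
      cokernel.π_desc, ← assoc, ← F.map_comp, ← op_comp]
    exact map_comp_cokernel_eq F (syzygyMap_comp g.unop f.unop)

/-- The canonical projection `F(ΩX) ⟶ S¹F(X)`. -/
def toSatellite (F : Aᵒᵖ ⥤ AddCommGrpCat.{w}) [F.Additive] (X : A) :
    F.obj (op (syzygy X)) ⟶ (satellite F).obj (op X) :=
  cokernel.π (restr F X)

instance (F : Aᵒᵖ ⥤ AddCommGrpCat.{w}) [F.Additive] (X : A) : Epi (toSatellite F X) :=
  inferInstanceAs (Epi (cokernel.π _))

lemma toSatellite_naturality (F : Aᵒᵖ ⥤ AddCommGrpCat.{w}) [F.Additive] {X Y : A} (f : X ⟶ Y) :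
    toSatellite F Y ≫ (satellite F).map f.op = F.map (syzygyMap f).op ≫ toSatellite F X :=
  cokernel.π_desc _ _ _

instance (F : Aᵒᵖ ⥤ AddCommGrpCat.{w}) [F.Additive] : (satellite F).Additive where
  map_add {X Y f g} := by
    change (satellite F).map (f.unop + g.unop).op =
      (satellite F).map f.unop.op + (satellite F).map g.unop.op
    rw [← cancel_epi (toSatellite F X.unop), Preadditive.comp_add, toSatellite_naturality,
      toSatellite_naturality, toSatellite_naturality, ← Preadditive.add_comp, ← F.map_add,
      ← op_add]
    exact map_comp_cokernel_eq F (syzygyMap_add f.unop g.unop)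

instance (F : Aᵒᵖ ⥤ AddCommGrpCat.{w}) [F.Additive] : VanishesOnProjectives (satellite F) where
  isZero P _ := by
    let s : P ⟶ Projective.over P := Projective.factorThru (𝟙 P) (Projective.π P)
    have hs : s ≫ Projective.π P = 𝟙 P := by simp [s]
    have h0 : (𝟙 _ - Projective.π P ≫ s) ≫ Projective.π P = 0 := by
      simp [hs]
    have hr : syzι P ≫ syzLift _ h0 = 𝟙 _ := by
      simp [← cancel_mono (syzι P)]
    have : IsSplitEpi (restr F P) := ⟨⟨F.map (syzLift _ h0).op, by
      rw [restr, ← F.map_comp, ← op_comp, hr, op_id, F.map_id]⟩⟩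
    exact isZero_cokernel_of_epi _

/-- The iterated right satellites: `S⁰F = F` and `Sⁿ⁺¹F = Sⁿ(S¹F)`. -/
def satelliteIter : ∀ (_ : ℕ) (F : Aᵒᵖ ⥤ AddCommGrpCat.{w}) [F.Additive],
    Aᵒᵖ ⥤ AddCommGrpCat.{w}
  | 0, F, _ => F
  | n + 1, F, _ => satelliteIter n (satellite F)

lemma isIso_toSatellite (G : Aᵒᵖ ⥤ AddCommGrpCat.{w}) [G.Additive] [VanishesOnProjectives G]
    (X : A) : IsIso (toSatellite G X) :=
  coequalizer.π_of_eq ((VanishesOnProjectives.isZero (G := G) _).eq_of_src (restr G X) 0)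

/-- Dimension shift: if `G` vanishes on projectives, then `Sⁿ G (X) ≅ G (Ωⁿ X)`. -/
def shiftObjIso : ∀ (n : ℕ) (G : Aᵒᵖ ⥤ AddCommGrpCat.{w}) [G.Additive] [VanishesOnProjectives G]
    (X : A), (satelliteIter n G).obj (op X) ≅ G.obj (op (syz n X))
  | 0, _, _, _, _ => Iso.refl _
  | n + 1, G, _, _, X =>
    shiftObjIso n (satellite G) X ≪≫
      (@asIso _ _ _ _ (toSatellite G (syz n X)) (isIso_toSatellite G _)).symm

lemma shiftObjIso_inv_naturality (n : ℕ) (G : Aᵒᵖ ⥤ AddCommGrpCat.{w}) [G.Additive]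
    [VanishesOnProjectives G] {X Y : A} (f : X ⟶ Y) :
    G.map (syzMap n f).op ≫ (shiftObjIso n G X).inv =
      (shiftObjIso n G Y).inv ≫ (satelliteIter n G).map f.op := by
  induction n generalizing G with
  | zero => exact (comp_id _).trans (id_comp _).symm
  | succ n ih =>
    have h : G.map (syzygyMap (syzMap n f)).op ≫ toSatellite G (syz n X) ≫
          (shiftObjIso n (satellite G) X).inv =
        (toSatellite G (syz n Y) ≫ (shiftObjIso n (satellite G) Y).inv) ≫
          (satelliteIter n (satellite G)).map f.op := by
      rw [← assoc, ← toSatellite_naturality, assoc, ih, assoc]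
    exact h

/-- Dimension shift: if `G` vanishes on projectives, then `G ∘ Ωⁿ ≅ Sⁿ G`. -/
def shiftIso (n : ℕ) (G : Aᵒᵖ ⥤ AddCommGrpCat.{w}) [G.Additive] [VanishesOnProjectives G] :
    compSyz G n ≅ satelliteIter n G :=
  NatIso.ofComponents (fun X => (shiftObjIso n G X.unop).symm)
    (fun f => shiftObjIso_inv_naturality n G f.unop)

end Functors

section Resolution

variable {A : Type u} [Category.{v} A] [Abelian A] [EnoughProjectives A]

/-- The differential `P(ΩX) ⟶ ΩX ⟶ P(X)`, where `P(Y)` is the chosen projective over `Y`. -/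
def resD (X : A) : Projective.over (syzygy X) ⟶ Projective.over X :=
  Projective.π (syzygy X) ≫ syzι X

@[simp]
lemma resD_π (X : A) : resD X ≫ Projective.π X = 0 := by simp [resD]

lemma resD_resD (X : A) : resD (syzygy X) ≫ resD X = 0 := by simp [resD]

lemma overMap_resD {X Y : A} (f : X ⟶ Y) :
    overMap (syzygyMap f) ≫ resD Y = resD X ≫ overMap f := by
  simp [resD]

/-- The projective resolution `⋯ ⟶ P₂ ⟶ P₁ ⟶ P₀` of `X`, where `Pₙ` is the chosen projective
over `Ωⁿ X`, viewed as a cochain complex in the opposite category. -/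
def resComplex (X : A) : CochainComplex Aᵒᵖ ℕ :=
  CochainComplex.of (fun n => op (Projective.over (syz n X))) (fun n => (resD (syz n X)).op)
    (fun n => congrArg Quiver.Hom.op (resD_resD (syz n X)))

lemma resComplex_d (X : A) (n : ℕ) :
    (resComplex X).d n (n + 1) = (resD (syz n X)).op :=
  CochainComplex.of_d (fun n => op (Projective.over (syz n X))) (fun n => (resD (syz n X)).op) n

lemma exact_resD_π (X : A) : (ShortComplex.mk (resD X) (Projective.π X) (resD_π X)).Exact := by
  have h : (ShortComplex.mk (syzι X) (Projective.π X) (syzι_π X)).Exact :=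
    ShortComplex.exact_kernel (Projective.π X)
  exact (ShortComplex.exact_iff_of_epi_of_isIso_of_mono
    ({ τ₁ := Projective.π (syzygy X), τ₂ := 𝟙 _, τ₃ := 𝟙 _, comm₁₂ := by simp [resD] } :
      ShortComplex.mk (resD X) (Projective.π X) (resD_π X) ⟶
        ShortComplex.mk (syzι X) (Projective.π X) (syzι_π X))).2 h

lemma exact_resD_resD (X : A) :
    (ShortComplex.mk (resD (syzygy X)) (resD X) (resD_resD X)).Exact :=
  (ShortComplex.exact_iff_of_epi_of_isIso_of_mono
    ({ τ₁ := 𝟙 _, τ₂ := 𝟙 _, τ₃ := syzι X, comm₂₃ := by simp [resD] } :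
      ShortComplex.mk (resD (syzygy X)) (Projective.π (syzygy X)) (resD_π _) ⟶
        ShortComplex.mk (resD (syzygy X)) (resD X) (resD_resD X))).1 (exact_resD_π _)

lemma exact_congr {C : Type*} [Category* C] [HasZeroMorphisms C] {X Y Z : C}
    {f f' : X ⟶ Y} {g g' : Y ⟶ Z} {w : f ≫ g = 0} (h : (ShortComplex.mk f g w).Exact)
    (hf : f = f') (hg : g = g') (w' : f' ≫ g' = 0) : (ShortComplex.mk f' g' w').Exact := by
  subst hf hg
  exact h

/-- The augmentation of the resolution. -/
def resι (X : A) : (CochainComplex.single₀ Aᵒᵖ).obj (op X) ⟶ resComplex X :=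
  (CochainComplex.fromSingle₀Equiv (resComplex X) (op X)).symm ⟨(Projective.π X).op, by
    rw [resComplex_d]
    exact congrArg Quiver.Hom.op (resD_π X)⟩

lemma resι_f_zero (X : A) : (resι X).f 0 = (Projective.π X).op :=
  CochainComplex.fromSingle₀Equiv_symm_apply_f_zero _ _

/-- The same resolution as an injective resolution of `op X` in the opposite category. -/
def resolution (X : A) : InjectiveResolution (op X) where
  cocomplex := resComplex X
  injective n := inferInstanceAs (Injective (op (Projective.over (syz n X))))
  ι := resι X
  quasiIso := ⟨fun n => by
    cases n with
    | zero =>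
      rw [CochainComplex.quasiIsoAt₀_iff, ShortComplex.quasiIso_iff_of_zeros]
      · have h : Mono ((resι X).f 0) := by
          rw [resι_f_zero]
          exact inferInstanceAs (Mono (Projective.π X).op)
        have w : (resι X).f 0 ≫ (resComplex X).d 0 1 = 0 := by
          rw [resι_f_zero, resComplex_d]
          exact congrArg Quiver.Hom.op (resD_π X)
        exact ⟨exact_congr (exact_resD_π X).op (resι_f_zero X).symm (resComplex_d X 0).symm w, h⟩
      all_goals rfl
    | succ n =>
      rw [quasiIsoAt_iff_exactAt]
      · rw [HomologicalComplex.exactAt_iff' _ n (n + 1) (n + 1 + 1) (by simp) (by simp)]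
        exact exact_congr (exact_resD_resD (syz n X)).op (resComplex_d X n).symm
          (resComplex_d X (n + 1)).symm ((resComplex X).d_comp_d _ _ _)
      · apply CochainComplex.exactAt_succ_single_obj⟩

/-- The chain map of resolutions induced by `f : X ⟶ Y`. -/
def resMap {X Y : A} (f : X ⟶ Y) : resComplex Y ⟶ resComplex X where
  f n := (overMap (syzMap n f)).op
  comm' i j hij := by
    obtain rfl : i + 1 = j := hij
    rw [resComplex_d, resComplex_d]
    exact congrArg Quiver.Hom.op (overMap_resD (syzMap i f)).symm

lemma resMap_comm {X Y : A} (f : X ⟶ Y) :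
    (resolution Y).ι.f 0 ≫ (resMap f).f 0 = f.op ≫ (resolution X).ι.f 0 := by
  change (resι Y).f 0 ≫ _ = _ ≫ (resι X).f 0
  rw [resι_f_zero, resι_f_zero]
  exact congrArg Quiver.Hom.op (overMap_π f)

end Resolution

section Sequence

variable {A : Type u} [Category.{v} A] [Abelian A] [EnoughProjectives A]
variable (F : Aᵒᵖ ⥤ AddCommGrpCat.{w}) [F.Additive]

/-- The right derived functors `RₙF` of the contravariant functor `F`, computed by projective
resolutions in `A`, that is, by injective resolutions in the opposite category. -/
abbrev rightDer (n : ℕ) : Aᵒᵖ ⥤ AddCommGrpCat.{w} := F.rightDerived n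

/-- The canonical natural transformation `ρ : F ⟶ R₀F`. -/
abbrev rho : F ⟶ rightDer F 0 := F.toRightDerivedZero

/-- The sub-stabilization `F̄` of `F`: the kernel of `ρ : F ⟶ R₀F`. -/
def subStab : Aᵒᵖ ⥤ AddCommGrpCat.{w} := kernel (rho F)

/-- The inclusion `F̄ ⟶ F`. -/
def subStabι : subStab F ⟶ F := kernel.ι (rho F)

lemma subStabι_rho : subStabι F ≫ rho F = 0 := kernel.condition _

instance : Mono (subStabι F) := inferInstanceAs (Mono (kernel.ι _))

instance (X : Aᵒᵖ) : Mono ((subStabι F).app X) := inferInstance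

instance : (subStab F).Additive where
  map_add {X Y f g} := by
    rw [← cancel_mono ((subStabι F).app Y)]
    simp [Preadditive.comp_add, Preadditive.add_comp]

instance : VanishesOnProjectives (subStab F) where
  isZero P _ := by
    have h : (subStabι F).app (op P) ≫ (rho F).app (op P) = 0 := by
      rw [← NatTrans.comp_app, subStabι_rho]; rfl
    rw [IsZero.iff_id_eq_zero, ← cancel_mono ((subStabι F).app (op P)),
      ← cancel_mono ((rho F).app (op P))]
    simp [h]

lemma exact_subStab (X : Aᵒᵖ) :
    (ShortComplex.mk ((subStabι F).app X) ((rho F).app X)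
      (by rw [← NatTrans.comp_app, subStabι_rho]; rfl)).Exact :=
  (ShortComplex.exact_kernel (rho F)).map ((evaluation _ _).obj X)

/-- The complex obtained by applying `F` to the projective resolution of `X`. -/
abbrev derComplex (X : A) : CochainComplex AddCommGrpCat.{w} ℕ :=
  (F.mapHomologicalComplex _).obj (resComplex X)

/-- `RₙF(X)` is the cohomology of `F` applied to the projective resolution of `X`. -/
def derIso (n : ℕ) (X : A) : (rightDer F n).obj (op X) ≅ (derComplex F X).homology n :=
  (resolution X).isoRightDerivedObj F n

/-- An element of `F(X)` that dies in `F(P)` lies in `F̄(X)`. -/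
lemma comp_rho_eq_zero {X : A} {T : AddCommGrpCat.{w}} (t : T ⟶ F.obj (op X))
    (h : t ≫ F.map (Projective.π X).op = 0) : t ≫ (rho F).app (op X) = 0 := by
  have h0 : t ≫ (resolution X).toRightDerivedZero' F = 0 := by
    rw [← cancel_mono (HomologicalComplex.iCycles _ _), assoc,
      InjectiveResolution.toRightDerivedZero'_comp_iCycles, zero_comp]
    exact (congrArg (t ≫ F.map ·) (resι_f_zero X)).trans h
  rw [(resolution X).toRightDerivedZero_eq F, reassoc_of% h0, zero_comp]

/-- The lift to `F̄(X)` of a map to `F(X)` that vanishes in `F(P)`, where `P` is the chosen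
projective over `X`. -/
def subStabLift {X : A} {T : AddCommGrpCat.{w}} (t : T ⟶ F.obj (op X))
    (h : t ≫ F.map (Projective.π X).op = 0) : T ⟶ (subStab F).obj (op X) :=
  (exact_subStab F (op X)).lift t (comp_rho_eq_zero F t h)

lemma subStabLift_ι {X : A} {T : AddCommGrpCat.{w}} (t : T ⟶ F.obj (op X))
    (h : t ≫ F.map (Projective.π X).op = 0) :
    subStabLift F t h ≫ (subStabι F).app (op X) = t :=
  (exact_subStab F (op X)).lift_f _ _

lemma derComplex_d (X : A) (n : ℕ) :
    (derComplex F X).d n (n + 1) = F.map (resD (syz n X)).op :=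
  congrArg F.map (resComplex_d X n)

/-- The map `F(Ωⁿ⁺¹X) ⟶ F(Pₙ₊₁)` induced by `Pₙ₊₁ ⟶ Ωⁿ⁺¹X`. -/
def toX (n : ℕ) (X : A) : F.obj (op (syzygy (syz n X))) ⟶ (derComplex F X).X (n + 1) :=
  F.map (Projective.π (syzygy (syz n X))).op

/-- The map `F(Pₙ) ⟶ F(Ωⁿ⁺¹X)` induced by `Ωⁿ⁺¹X ⟶ Pₙ`. -/
def fromX (n : ℕ) (X : A) : (derComplex F X).X n ⟶ F.obj (op (syzygy (syz n X))) :=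
  restr F (syz n X)

lemma fromX_toX (n : ℕ) (X : A) : fromX F n X ≫ toX F n X = (derComplex F X).d n (n + 1) :=
  ((F.map_comp _ _).symm).trans (derComplex_d F X n).symm

lemma toX_d (n : ℕ) (X : A) : toX F n X ≫ (derComplex F X).d (n + 1) (n + 2) = 0 := by
  have h : F.map (Projective.π (syzygy (syz n X))).op ≫ F.map (resD (syzygy (syz n X))).op = 0 := by
    rw [← F.map_comp, ← op_comp, resD_π, op_zero, F.map_zero]
  exact (congrArg (toX F n X ≫ ·) (derComplex_d F X (n + 1))).trans h

lemma d_fromX (n : ℕ) (X : A) :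
    (derComplex F X).d n (n + 1) ≫ fromX F (n + 1) X = 0 := by
  have h : F.map (resD (syz n X)).op ≫ F.map (syzι (syzygy (syz n X))).op = 0 := by
    rw [← F.map_comp, ← op_comp, resD, syzι_π_assoc, op_zero, F.map_zero]
  exact (congrArg (· ≫ fromX F (n + 1) X) (derComplex_d F X n)).trans h

/-- The chain map induced by `f : X ⟶ Y` after applying `F`. -/
abbrev derMap {X Y : A} (f : X ⟶ Y) : derComplex F Y ⟶ derComplex F X :=
  (F.mapHomologicalComplex _).map (resMap f)

lemma toX_naturality (n : ℕ) {X Y : A} (f : X ⟶ Y) :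
    toX F n Y ≫ (derMap F f).f (n + 1) =
      F.map (syzygyMap (syzMap n f)).op ≫ toX F n X := by
  have h := congrArg (fun g => F.map (Quiver.Hom.op g)) (overMap_π (syzygyMap (syzMap n f)))
  simp only [op_comp, F.map_comp] at h
  exact h

lemma fromX_naturality (n : ℕ) {X Y : A} (f : X ⟶ Y) :
    (derMap F f).f n ≫ fromX F n X = fromX F n Y ≫ F.map (syzygyMap (syzMap n f)).op :=
  (restr_naturality F (syzMap n f)).symm

/-- The map `F(Ωⁿ⁺¹X) ⟶ Hⁿ⁺¹(F(P))` induced by `Pₙ₊₁ ⟶ Ωⁿ⁺¹X`. -/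
def toHomology (n : ℕ) (X : A) :
    F.obj (op (syzygy (syz n X))) ⟶ (derComplex F X).homology (n + 1) :=
  (derComplex F X).liftCycles (toX F n X) (n + 2) (by simp) (toX_d F n X) ≫
    (derComplex F X).homologyπ (n + 1)

lemma restr_toHomology (n : ℕ) (X : A) : restr F (syz n X) ≫ toHomology F n X = 0 := by
  change fromX F n X ≫ toHomology F n X = 0
  rw [toHomology, HomologicalComplex.comp_liftCycles_assoc]
  exact HomologicalComplex.liftCycles_homologyπ_eq_zero_of_boundary _ _ _ _ (𝟙 _)
    ((fromX_toX F n X).trans (id_comp _).symm)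

lemma toHomology_naturality (n : ℕ) {X Y : A} (f : X ⟶ Y) :
    toHomology F n Y ≫ HomologicalComplex.homologyMap (derMap F f) (n + 1) =
      F.map (syzygyMap (syzMap n f)).op ≫ toHomology F n X := by
  rw [toHomology, toHomology, assoc, HomologicalComplex.homologyπ_naturality, ← assoc, ← assoc]
  congr 1
  rw [← cancel_mono (HomologicalComplex.iCycles _ _)]
  simp only [assoc, HomologicalComplex.cyclesMap_i, HomologicalComplex.liftCycles_i,
    HomologicalComplex.liftCycles_i_assoc]
  exact toX_naturality F n f

lemma derIso_hom_naturality (n : ℕ) {X Y : A} (f : X ⟶ Y) :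
    (rightDer F n).map f.op ≫ (derIso F n X).hom =
      (derIso F n Y).hom ≫ HomologicalComplex.homologyMap (derMap F f) n :=
  InjectiveResolution.isoRightDerivedObj_hom_naturality f.op (resolution Y) (resolution X)
    (resMap f) (resMap_comm f) F n

lemma derIso_inv_naturality (n : ℕ) {X Y : A} (f : X ⟶ Y) :
    (derIso F n Y).inv ≫ (rightDer F n).map f.op =
      HomologicalComplex.homologyMap (derMap F f) n ≫ (derIso F n X).inv :=
  InjectiveResolution.isoRightDerivedObj_inv_naturality f.op (resolution Y) (resolution X)
    (resMap f) (resMap_comm f) F n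

/-- The map `S¹F(Ωⁿ X) ⟶ Rₙ₊₁F(X)` induced by `F(Ωⁿ⁺¹X) ⟶ Hⁿ⁺¹(F(P))`. -/
def satelliteToDer (n : ℕ) (X : A) :
    (satellite F).obj (op (syz n X)) ⟶ (rightDer F (n + 1)).obj (op X) :=
  cokernel.desc (restr F (syz n X)) (toHomology F n X) (restr_toHomology F n X) ≫
    (derIso F (n + 1) X).inv

lemma toSatellite_satelliteToDer (n : ℕ) (X : A) :
    toSatellite F (syz n X) ≫ satelliteToDer F n X =
      toHomology F n X ≫ (derIso F (n + 1) X).inv :=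
  cokernel.π_desc_assoc _ _ _ _

lemma satelliteToDer_naturality (n : ℕ) {X Y : A} (f : X ⟶ Y) :
    (satellite F).map (syzMap n f).op ≫ satelliteToDer F n X =
      satelliteToDer F n Y ≫ (rightDer F (n + 1)).map f.op := by
  rw [← cancel_epi (toSatellite F (syz n Y)), ← assoc, toSatellite_naturality, assoc,
    toSatellite_satelliteToDer, ← assoc, ← assoc, toSatellite_satelliteToDer,
    ← toHomology_naturality, assoc, assoc, derIso_inv_naturality]

/-- The natural transformation `Sⁿ⁺¹F ≅ S¹F ∘ Ωⁿ ⟶ Rₙ₊₁F`. -/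
def satToDer (n : ℕ) : satelliteIter (n + 1) F ⟶ rightDer F (n + 1) :=
  (shiftIso n (satellite F)).inv ≫
    { app := fun X => satelliteToDer F n X.unop
      naturality := fun _ _ f => satelliteToDer_naturality F n f.unop }

/-- The natural transformation `F̄ ∘ Ωⁿ⁺¹ ⟶ S¹F ∘ Ωⁿ ≅ Sⁿ⁺¹F`, given by
`F̄(Ωⁿ⁺¹X) ⟶ F(Ωⁿ⁺¹X) ⟶ S¹F(Ωⁿ X)`. -/
def compSyzToSat (n : ℕ) : compSyz (subStab F) (n + 1) ⟶ satelliteIter (n + 1) F :=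
  { app := fun X => (subStabι F).app (op (syzygy (syz n X.unop))) ≫ toSatellite F (syz n X.unop)
    naturality := fun X Y f => by
      have h : (subStab F).map (syzygyMap (syzMap n f.unop)).op ≫
            (subStabι F).app (op (syzygy (syz n Y.unop))) ≫ toSatellite F (syz n Y.unop) =
          ((subStabι F).app (op (syzygy (syz n X.unop))) ≫ toSatellite F (syz n X.unop)) ≫
            (satellite F).map (syzMap n f.unop).op := by
        rw [assoc, toSatellite_naturality, NatTrans.naturality_assoc]
      exact h } ≫
    (shiftIso n (satellite F)).hom

lemma d_prev_fromX (n : ℕ) (X : A) :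
    (derComplex F X).d ((ComplexShape.up ℕ).prev n) n ≫ fromX F n X = 0 := by
  cases n with
  | zero => rw [(derComplex F X).shape _ _ (by simp), zero_comp]
  | succ n =>
    rw [CochainComplex.prev_nat_succ]
    exact d_fromX F n X

/-- The map `Hⁿ(F(P)) ⟶ F(Ωⁿ⁺¹X)` induced by `Ωⁿ⁺¹X ⟶ Pₙ`. -/
def fromHomology (n : ℕ) (X : A) :
    (derComplex F X).homology n ⟶ F.obj (op (syzygy (syz n X))) :=
  (derComplex F X).homologyι n ≫
    (derComplex F X).descOpcycles (fromX F n X) _ rfl (d_prev_fromX F n X)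

lemma homologyπ_fromHomology (n : ℕ) (X : A) :
    (derComplex F X).homologyπ n ≫ fromHomology F n X =
      (derComplex F X).iCycles n ≫ fromX F n X := by
  rw [fromHomology, HomologicalComplex.homology_π_ι_assoc, HomologicalComplex.p_descOpcycles]

lemma fromHomology_comp (n : ℕ) (X : A) :
    fromHomology F n X ≫ F.map (Projective.π (syzygy (syz n X))).op = 0 := by
  have h : fromHomology F n X ≫ toX F n X = 0 := by
    rw [← cancel_epi ((derComplex F X).homologyπ n), ← assoc, homologyπ_fromHomology, assoc,
      fromX_toX, HomologicalComplex.iCycles_d, comp_zero]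
  exact h

lemma fromHomology_naturality (n : ℕ) {X Y : A} (f : X ⟶ Y) :
    HomologicalComplex.homologyMap (derMap F f) n ≫ fromHomology F n X =
      fromHomology F n Y ≫ F.map (syzygyMap (syzMap n f)).op := by
  rw [← cancel_epi ((derComplex F Y).homologyπ n), HomologicalComplex.homologyπ_naturality_assoc,
    homologyπ_fromHomology, HomologicalComplex.cyclesMap_i_assoc, fromX_naturality, ← assoc,
    ← assoc, homologyπ_fromHomology]

/-- The map `RₙF(X) ⟶ F̄(Ωⁿ⁺¹X)` induced by `Ωⁿ⁺¹X ⟶ Pₙ`. -/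
def derToSyz (n : ℕ) (X : A) :
    (rightDer F n).obj (op X) ⟶ (subStab F).obj (op (syzygy (syz n X))) :=
  (derIso F n X).hom ≫ subStabLift F (fromHomology F n X) (fromHomology_comp F n X)

lemma derToSyz_ι (n : ℕ) (X : A) :
    derToSyz F n X ≫ (subStabι F).app _ = (derIso F n X).hom ≫ fromHomology F n X := by
  rw [derToSyz, assoc, subStabLift_ι]

lemma derToSyz_naturality (n : ℕ) {X Y : A} (f : X ⟶ Y) :
    (rightDer F n).map f.op ≫ derToSyz F n X =
      derToSyz F n Y ≫ (subStab F).map (syzygyMap (syzMap n f)).op := by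
  rw [← cancel_mono ((subStabι F).app _), assoc, assoc, derToSyz_ι, NatTrans.naturality,
    ← assoc, ← assoc, derToSyz_ι, derIso_hom_naturality, assoc, assoc, fromHomology_naturality]

/-- The connecting natural transformation `RₙF ⟶ F̄ ∘ Ωⁿ⁺¹`. -/
def connecting (n : ℕ) : rightDer F n ⟶ compSyz (subStab F) (n + 1) where
  app X := derToSyz F n X.unop
  naturality _ _ f := derToSyz_naturality F n f.unop

/-- The natural transformation `β : R₀F ⟶ F̄ ∘ Ω`. -/
def beta : rightDer F 0 ⟶ compSyz (subStab F) 1 := connecting F 0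

/-- The first column `F̄, F̄ ∘ Ω, F̄ ∘ Ω², …` of the right fundamental sequence. -/
def rfsSub : ℕ → (Aᵒᵖ ⥤ AddCommGrpCat.{w})
  | 0 => subStab F
  | n + 1 => compSyz (subStab F) (n + 1)

/-- The maps `F̄ ⟶ F` and `F̄ ∘ Ωⁿ ⟶ SⁿF` (for `n ≥ 1`) of the right fundamental sequence. -/
def rfsSubToSat : ∀ n : ℕ, rfsSub F n ⟶ satelliteIter n F
  | 0 => subStabι F
  | n + 1 => compSyzToSat F n

/-- The maps `ρ : F ⟶ R₀F` and `SⁿF ⟶ RₙF` (for `n ≥ 1`) of the right fundamental sequence. -/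
def rfsSatToDer : ∀ n : ℕ, satelliteIter n F ⟶ rightDer F n
  | 0 => rho F
  | n + 1 => satToDer F n

/-- The maps `RₙF ⟶ F̄ ∘ Ωⁿ⁺¹` of the right fundamental sequence; the first one is `β`. -/
def rfsDerToSub (n : ℕ) : rightDer F n ⟶ rfsSub F (n + 1) := connecting F n

end Sequence

section Properties

variable {A : Type u} [Category.{v} A] [Abelian A]

/-- A contravariant additive functor `F` is half-exact if for every short exact sequence
`0 ⟶ X₁ ⟶ X₂ ⟶ X₃ ⟶ 0` the sequence `F(X₃) ⟶ F(X₂) ⟶ F(X₁)` is exact. -/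
def IsHalfExact (F : Aᵒᵖ ⥤ AddCommGrpCat.{w}) [F.Additive] : Prop :=
  ∀ S : ShortComplex A, S.ShortExact → (S.op.map F).Exact

/-- A contravariant additive functor `F` is left-exact if for every exact sequence
`X₁ ⟶ X₂ ⟶ X₃ ⟶ 0` the sequence `0 ⟶ F(X₃) ⟶ F(X₂) ⟶ F(X₁)` is exact. -/
def IsLeftExact (F : Aᵒᵖ ⥤ AddCommGrpCat.{w}) [F.Additive] : Prop :=
  ∀ S : ShortComplex A, S.Exact → Epi S.g → (S.op.map F).Exact ∧ Mono (F.map S.g.op)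

/-- A sequence `X ⟶ Y ⟶ Z` is exact at `Y` (in particular, the composition is zero). -/
def ExactAt {C : Type*} [Category* C] [Abelian C] {X Y Z : C} (f : X ⟶ Y) (g : Y ⟶ Z) : Prop :=
  ∃ h : f ≫ g = 0, (ShortComplex.mk f g h).Exact

end Properties

end

end FundamentalSequence

/-! Everything is checked at an object `X` on cocycles of F(P). Write f : F(Pₙ) ⟶ F(Ωⁿ⁺¹X) (`fromX`)
and t : F(Ωⁿ⁺¹X) ⟶ F(Pₙ₊₁) (`toX`); the differential is d = t ∘ f. In degree 0 a class is just a
cocycle, and ρ sends x to F(π)x, so F̄(X) is the kernel of F(π) (`rho_eq_zero_iff`). Hence F̄(Ωⁿ⁺¹X)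
= ker t, while S¹F(ΩⁿX) = coker f. For any composable f and t the sequence ker(tf) ⟶ ker t ⟶ coker f
⟶ coker(tf) is exact. Since Rₙ F(X) is a quotient of ker(tf) by elements that f kills, and Rₙ₊₁F(X)
is a subgroup of coker(tf), this gives exactness away from the derived functors for every F.

A class in RₙF(X) dies in F̄(Ωⁿ⁺¹X) exactly when its cocycle restricts to zero on Ωⁿ⁺¹X.
Half-exactness on 0 ⟶ Ωⁿ⁺¹X ⟶ Pₙ ⟶ ΩⁿX ⟶ 0 then lifts the cocycle to F(ΩⁿX), which is the missing
exactness. If F(m) is onto, every element of F̄(ΩX) lifts to F(P₀), and the lift is a cocycle; if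
F(π) is injective, F̄ = 0.

Finally, ρ is invertible exactly when 0 ⟶ F(X) ⟶ F(P₀) ⟶ F(P₁) is exact for all X. Left-exactness
contains this; conversely, an arbitrary right exact sequence is compared with these resolutions by
lifting maps from projectives. -/

namespace FundamentalSequence

noncomputable section

section Pointwise

/-- Exactness of a sequence of functors can be checked on elements. -/
lemma exactAt_of_app {C : Type u} [Category.{v} C] {G H K : C ⥤ AddCommGrpCat.{w}}
    {f : G ⟶ H} {g : H ⟶ K} (h0 : f ≫ g = 0)
    (h : ∀ (X : C) (y : H.obj X), g.app X y = 0 → ∃ x, f.app X x = y) : ExactAt f g := by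
  refine ⟨h0, ?_⟩
  -- Evaluation at an object preserves homology, and a functor is zero when all its values are.
  rw [ShortComplex.exact_iff_isZero_homology, Functor.isZero_iff]
  intro X
  let S := ShortComplex.mk f g h0
  have hX : (S.map ((evaluation _ _).obj X)).Exact := by
    rw [ShortComplex.ab_exact_iff]
    exact h X
  rw [ShortComplex.exact_iff_isZero_homology] at hX
  exact hX.of_iso (S.mapHomologyIso ((evaluation _ _).obj X)).symm

end Pointwise

/-! ### Formulas on cocycles for the maps of the sequence -/

section Classes

variable {A : Type u} [Category.{v} A] [Abelian A] [EnoughProjectives A]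
variable (F : Aᵒᵖ ⥤ AddCommGrpCat.{w}) [F.Additive]

lemma map_map_apply {X Y Z : A} (f : X ⟶ Y) (g : Y ⟶ Z) (x : F.obj (op Z)) :
    F.map f.op (F.map g.op x) = F.map (f ≫ g).op x := by
  rw [op_comp, F.map_comp, ConcreteCategory.comp_apply]

/-- The class in `RₙF(X)` of a cocycle of `F(P)`. -/
def derClass (n : ℕ) (X : A) : (derComplex F X).cycles n ⟶ (rightDer F n).obj (op X) :=
  (derComplex F X).homologyπ n ≫ (derIso F n X).inv

instance (n : ℕ) (X : A) : Epi (derClass F n X) :=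
  inferInstanceAs (Epi (_ ≫ _))

/-- There are no coboundaries in degree 0. -/
instance (X : A) : IsIso (derClass F 0 X) :=
  inferInstanceAs (IsIso ((CochainComplex.isoHomologyπ₀ _).hom ≫ _))

lemma derClass_surjective (n : ℕ) (X : A) : Function.Surjective (derClass F n X) :=
  (AddCommGrpCat.epi_iff_surjective _).1 inferInstance

lemma exists_iCycles_eq (n : ℕ) (X : A) (z : (derComplex F X).X n)
    (hz : (derComplex F X).d n (n + 1) z = 0) :
    ∃ c : (derComplex F X).cycles n, (derComplex F X).iCycles n c = z := by
  have h : (ShortComplex.mk ((derComplex F X).iCycles n) ((derComplex F X).d n (n + 1))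
      (HomologicalComplex.iCycles_d _ _ _)).Exact :=
    ShortComplex.exact_of_f_is_kernel _ ((derComplex F X).cyclesIsKernel n (n + 1) (by simp))
  exact (ShortComplex.ab_exact_iff _).1 h z hz

lemma d_iCycles (n : ℕ) (X : A) (c : (derComplex F X).cycles n) :
    (derComplex F X).d n (n + 1) ((derComplex F X).iCycles n c) = 0 := by
  rw [← ConcreteCategory.comp_apply, HomologicalComplex.iCycles_d]
  rfl

lemma iCycles_injective (n : ℕ) (X : A) : Function.Injective ((derComplex F X).iCycles n) :=
  (AddCommGrpCat.mono_iff_injective _).1 inferInstance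

lemma derClass_zero_injective (X : A) : Function.Injective (derClass F 0 X) :=
  (AddCommGrpCat.mono_iff_injective _).1 inferInstance

/-- A cocycle with trivial class is a coboundary. -/
lemma exists_d_eq_of_derClass_eq_zero (n : ℕ) (X : A) (c : (derComplex F X).cycles (n + 1))
    (hc : derClass F (n + 1) X c = 0) :
    ∃ w, (derComplex F X).d n (n + 1) w = (derComplex F X).iCycles (n + 1) c := by
  have h : (ShortComplex.mk ((derComplex F X).toCycles n (n + 1))
      ((derComplex F X).homologyπ (n + 1)) (by simp)).Exact :=
    ShortComplex.exact_of_g_is_cokernel _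
      ((derComplex F X).homologyIsCokernel n (n + 1) (by simp))
  have hc' : (derComplex F X).homologyπ (n + 1) c = 0 := by
    apply (AddCommGrpCat.mono_iff_injective (derIso F (n + 1) X).inv).1 inferInstance
    rw [← ConcreteCategory.comp_apply, map_zero]
    exact hc
  obtain ⟨w, hw⟩ := (ShortComplex.ab_exact_iff _).1 h c hc'
  refine ⟨w, ?_⟩
  rw [← hw, ← (derComplex F X).toCycles_i n (n + 1), ConcreteCategory.comp_apply]

/-- Computes the connecting map on representatives. The values are compared in F, where the
injective `subStabι` loses nothing. -/
lemma derToSyz_derClass (n : ℕ) (X : A) (c : (derComplex F X).cycles n) :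
    (subStabι F).app _ (derToSyz F n X (derClass F n X c)) =
      fromX F n X ((derComplex F X).iCycles n c) := by
  have h : derClass F n X ≫ derToSyz F n X ≫ (subStabι F).app _ =
      (derComplex F X).iCycles n ≫ fromX F n X := by
    rw [derToSyz_ι, derClass, assoc, Iso.inv_hom_id_assoc, homologyπ_fromHomology]
  exact ConcreteCategory.congr_hom h c

lemma subStabι_injective (X : A) : Function.Injective ((subStabι F).app (op X)) :=
  (AddCommGrpCat.mono_iff_injective _).1 inferInstance

/-- The cocycle in `F(P₀)` given by an element of `F(X)`. -/
def rhoCycle (X : A) : F.obj (op X) ⟶ (derComplex F X).cycles 0 :=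
  (resolution X).toRightDerivedZero' F

lemma rho_eq_derClass (X : A) (x : F.obj (op X)) :
    (rho F).app (op X) x = derClass F 0 X (rhoCycle F X x) :=
  ConcreteCategory.congr_hom ((resolution X).toRightDerivedZero_eq F) x

lemma iCycles_rhoCycle (X : A) (x : F.obj (op X)) :
    (derComplex F X).iCycles 0 (rhoCycle F X x) = F.map (Projective.π X).op x := by
  have h := (resolution X).toRightDerivedZero'_comp_iCycles F
  exact ConcreteCategory.congr_hom (h.trans (congrArg F.map (resι_f_zero X))) x

/-- Both the class map in degree 0 and the inclusion of cocycles are injective, so only F(π)x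
matters. This turns membership in F̄ into an equation in F(P₀). -/
lemma rho_eq_zero_iff (X : A) (x : F.obj (op X)) :
    (rho F).app (op X) x = 0 ↔ F.map (Projective.π X).op x = 0 := by
  rw [rho_eq_derClass, map_eq_zero_iff _ (derClass_zero_injective F X),
    ← map_eq_zero_iff _ (iCycles_injective F 0 X)]
  exact Eq.congr_left (iCycles_rhoCycle F X x)

lemma rho_subStabι (X : A) (x : (subStab F).obj (op X)) :
    (rho F).app (op X) ((subStabι F).app (op X) x) = 0 :=
  ConcreteCategory.congr_hom (congrArg (fun t => t.app (op X)) (subStabι_rho F)) x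

lemma map_π_subStabι (X : A) (x : (subStab F).obj (op X)) :
    F.map (Projective.π X).op ((subStabι F).app (op X) x) = 0 :=
  (rho_eq_zero_iff F X _).1 (rho_subStabι F X x)

lemma exists_subStabι_eq (X : A) (x : F.obj (op X)) (h : F.map (Projective.π X).op x = 0) :
    ∃ y, (subStabι F).app (op X) y = x :=
  (ShortComplex.ab_exact_iff _).1 (exact_subStab F (op X)) x ((rho_eq_zero_iff F X x).2 h)

/-- The cocycle in `F(Pₙ₊₁)` given by an element of `F(Ωⁿ⁺¹X)`. -/
def syzCycle (n : ℕ) (X : A) :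
    F.obj (op (syzygy (syz n X))) ⟶ (derComplex F X).cycles (n + 1) :=
  (derComplex F X).liftCycles (toX F n X) (n + 2) (by simp) (toX_d F n X)

lemma iCycles_syzCycle (n : ℕ) (X : A) (u : F.obj (op (syzygy (syz n X)))) :
    (derComplex F X).iCycles (n + 1) (syzCycle F n X u) = toX F n X u :=
  ConcreteCategory.congr_hom
    ((derComplex F X).liftCycles_i (toX F n X) (n + 2) (by simp) (toX_d F n X)) u

lemma satelliteToDer_toSatellite (n : ℕ) (X : A) (u : F.obj (op (syzygy (syz n X)))) :
    satelliteToDer F n X (toSatellite F (syz n X) u) =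
      derClass F (n + 1) X (syzCycle F n X u) := by
  have h : toSatellite F (syz n X) ≫ satelliteToDer F n X =
      syzCycle F n X ≫ derClass F (n + 1) X := by
    rw [toSatellite_satelliteToDer, toHomology, assoc]
    rfl
  exact ConcreteCategory.congr_hom h u

lemma toSatellite_surjective (X : A) : Function.Surjective (toSatellite F X) :=
  (AddCommGrpCat.epi_iff_surjective _).1 inferInstance

lemma toSatellite_restr (X : A) (z : F.obj (op (Projective.over X))) :
    toSatellite F X (restr F X z) = 0 :=
  ConcreteCategory.congr_hom (cokernel.condition (restr F X)) z

lemma exists_restr_eq (X : A) (u : F.obj (op (syzygy X))) (h : toSatellite F X u = 0) :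
    ∃ z, restr F X z = u :=
  (ShortComplex.ab_exact_iff _).1 (ShortComplex.exact_cokernel (restr F X)) u h

lemma toX_fromX (n : ℕ) (X : A) (z : (derComplex F X).X n) :
    toX F n X (fromX F n X z) = (derComplex F X).d n (n + 1) z :=
  ConcreteCategory.congr_hom (fromX_toX F n X) z

lemma map_syzι_map_π (X : A) (x : F.obj (op X)) :
    F.map (syzι X).op (F.map (Projective.π X).op x) = 0 := by
  rw [map_map_apply, syzι_π, op_zero, F.map_zero]
  rfl

end Classes

/-! ### Compositions and exactness at a fixed object -/

section Exactness

variable {A : Type u} [Category.{v} A] [Abelian A] [EnoughProjectives A]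
variable (F : Aᵒᵖ ⥤ AddCommGrpCat.{w}) [F.Additive]

lemma derToSyz_rho (X : A) (x : F.obj (op X)) :
    derToSyz F 0 X ((rho F).app (op X) x) = 0 := by
  apply subStabι_injective
  rw [map_zero, rho_eq_derClass]
  refine (derToSyz_derClass F 0 X _).trans
    ((congrArg (fromX F 0 X) (iCycles_rhoCycle F X x)).trans ?_)
  exact map_syzι_map_π F X x

lemma rho_connecting : rho F ≫ connecting F 0 = 0 := by
  ext X x
  exact derToSyz_rho F X.unop x

lemma derToSyz_satelliteToDer (n : ℕ) (X : A) (y : (satellite F).obj (op (syz n X))) :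
    derToSyz F (n + 1) X (satelliteToDer F n X y) = 0 := by
  obtain ⟨u, rfl⟩ := toSatellite_surjective F _ y
  apply subStabι_injective
  rw [map_zero, satelliteToDer_toSatellite]
  refine (derToSyz_derClass F (n + 1) X _).trans ?_
  rw [iCycles_syzCycle]
  exact map_syzι_map_π F _ u

/-- Elements of F̄ die in F(Pₙ₊₁), so the cocycle itself vanishes, not merely its class. -/
lemma satelliteToDer_subStabι (n : ℕ) (X : A) (x : (subStab F).obj (op (syzygy (syz n X)))) :
    satelliteToDer F n X (toSatellite F (syz n X) ((subStabι F).app _ x)) = 0 := by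
  have h : syzCycle F n X ((subStabι F).app _ x) = 0 := by
    apply iCycles_injective
    rw [iCycles_syzCycle, map_zero]
    exact map_π_subStabι F _ x
  rw [satelliteToDer_toSatellite, h, map_zero]

lemma toSatellite_derToSyz (n : ℕ) (X : A) (r : (rightDer F n).obj (op X)) :
    toSatellite F (syz n X) ((subStabι F).app _ (derToSyz F n X r)) = 0 := by
  obtain ⟨c, rfl⟩ := derClass_surjective F n X r
  rw [derToSyz_derClass]
  exact toSatellite_restr F (syz n X) _

/-- Any lift z is automatically a cocycle: its differential is `toX` of an element of F̄, hence
zero. The lift is a hypothesis because it comes either from vanishing in the satellite or from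
surjectivity of F(m). -/
lemma exists_derToSyz_eq_of_fromX (n : ℕ) (X : A) (x : (subStab F).obj (op (syzygy (syz n X))))
    (z : (derComplex F X).X n) (hz : fromX F n X z = (subStabι F).app _ x) :
    ∃ r, derToSyz F n X r = x := by
  obtain ⟨c, rfl⟩ := exists_iCycles_eq F n X z (by
    rw [← toX_fromX, hz]
    exact map_π_subStabι F _ x)
  refine ⟨derClass F n X c, subStabι_injective F _ ?_⟩
  rw [derToSyz_derClass, hz]

lemma exists_derToSyz_eq (n : ℕ) (X : A) (x : (subStab F).obj (op (syzygy (syz n X))))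
    (hx : toSatellite F (syz n X) ((subStabι F).app _ x) = 0) :
    ∃ r, derToSyz F n X r = x := by
  obtain ⟨z, hz⟩ := exists_restr_eq F _ _ hx
  exact exists_derToSyz_eq_of_fromX F n X x z hz

lemma exists_subStab_eq_of_satelliteToDer_eq_zero (n : ℕ) (X : A)
    (y : (satellite F).obj (op (syz n X))) (hy : satelliteToDer F n X y = 0) :
    ∃ x, toSatellite F (syz n X) ((subStabι F).app _ x) = y := by
  obtain ⟨u, rfl⟩ := toSatellite_surjective F _ y
  rw [satelliteToDer_toSatellite] at hy
  obtain ⟨w, hw⟩ := exists_d_eq_of_derClass_eq_zero F n X _ hy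
  rw [iCycles_syzCycle, ← toX_fromX] at hw
  -- The image of u in F(Pₙ₊₁) is the coboundary of w, which is also the image of `fromX F n X w`.
  -- Subtracting the latter moves u into F̄ without changing its class in the satellite.
  obtain ⟨x, hx⟩ := exists_subStabι_eq F _ (u - fromX F n X w) (by
    rw [map_sub]
    exact sub_eq_zero.2 hw.symm)
  refine ⟨x, ?_⟩
  rw [hx, map_sub]
  exact (congrArg _ (toSatellite_restr F (syz n X) w)).trans (sub_zero _)

/-! ### Half-exact functors: lifting classes of the derived functors -/

/-- If `F` is half-exact, a cocycle in `F(Pₙ)` that dies in `F(Ωⁿ⁺¹X)` comes from `F(ΩⁿX)`. -/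
lemma IsHalfExact.exists_map_π_eq {F : Aᵒᵖ ⥤ AddCommGrpCat.{w}} [F.Additive] (hF : IsHalfExact F)
    (X : A) (z : F.obj (op (Projective.over X))) (hz : restr F X z = 0) :
    ∃ y, F.map (Projective.π X).op y = z := by
  have h : (ShortComplex.mk (syzι X) (Projective.π X) (syzι_π X)).ShortExact :=
    { exact := ShortComplex.exact_kernel (Projective.π X)
      mono_f := inferInstanceAs (Mono (syzι X))
      epi_g := inferInstanceAs (Epi (Projective.π X)) }
  exact (ShortComplex.ab_exact_iff _).1 (hF _ h) z hz

lemma rho_eq_derClass_of_map_π_eq (X : A) (c : (derComplex F X).cycles 0) (x : F.obj (op X))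
    (hx : F.map (Projective.π X).op x = (derComplex F X).iCycles 0 c) :
    (rho F).app (op X) x = derClass F 0 X c := by
  rw [rho_eq_derClass]
  congr 1
  exact iCycles_injective F 0 X ((iCycles_rhoCycle F X x).trans hx)

lemma exists_rho_eq_of_derToSyz_eq_zero {F : Aᵒᵖ ⥤ AddCommGrpCat.{w}} [F.Additive]
    (hF : IsHalfExact F) (X : A) (r : (rightDer F 0).obj (op X)) (hr : derToSyz F 0 X r = 0) :
    ∃ x, (rho F).app (op X) x = r := by
  obtain ⟨c, rfl⟩ := derClass_surjective F 0 X r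
  have h := derToSyz_derClass F 0 X c
  rw [hr, map_zero] at h
  obtain ⟨x, hx⟩ := hF.exists_map_π_eq X _ h.symm
  exact ⟨x, rho_eq_derClass_of_map_π_eq F X c x hx⟩

lemma exists_satelliteToDer_eq {F : Aᵒᵖ ⥤ AddCommGrpCat.{w}} [F.Additive]
    (hF : IsHalfExact F) (n : ℕ) (X : A) (r : (rightDer F (n + 1)).obj (op X))
    (hr : derToSyz F (n + 1) X r = 0) :
    ∃ y, satelliteToDer F n X y = r := by
  obtain ⟨c, rfl⟩ := derClass_surjective F (n + 1) X r
  have h := derToSyz_derClass F (n + 1) X c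
  rw [hr, map_zero] at h
  -- The cocycle lies in F(Pₙ₊₁), so the relevant syzygy sequence is that of Ωⁿ⁺¹X; the lift u then
  -- lies in F(Ωⁿ⁺¹X), the source of `toSatellite` at ΩⁿX.
  obtain ⟨u, hu⟩ := hF.exists_map_π_eq (syz (n + 1) X) _ h.symm
  refine ⟨toSatellite F (syz n X) u, ?_⟩
  refine (satelliteToDer_toSatellite F n X u).trans (congrArg _ ?_)
  exact iCycles_injective F _ X ((iCycles_syzCycle F n X u).trans hu)

end Exactness

/-! ### The sequence of functors -/

section FunctorSequence

variable {A : Type u} [Category.{v} A] [Abelian A] [EnoughProjectives A]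
variable (F : Aᵒᵖ ⥤ AddCommGrpCat.{w}) [F.Additive]

/-- The isomorphism `S¹F(ΩⁿX) ≅ Sⁿ⁺¹F(X)`. -/
def satIso (n : ℕ) (X : A) :
    (satellite F).obj (op (syz n X)) ≅ (satelliteIter (n + 1) F).obj (op X) :=
  (shiftIso n (satellite F)).app (op X)

lemma satIso_surjective (n : ℕ) (X : A) : Function.Surjective (satIso F n X).hom :=
  (AddCommGrpCat.epi_iff_surjective _).1 inferInstance

lemma satIso_injective (n : ℕ) (X : A) : Function.Injective (satIso F n X).hom :=
  (AddCommGrpCat.mono_iff_injective _).1 inferInstance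

/-- The dimension shift cancels against the inverse built into `satToDer`, so statements about
iterated satellites reduce to S¹F(ΩⁿX). -/
lemma satToDer_satIso (n : ℕ) (X : A) (y : (satellite F).obj (op (syz n X))) :
    (satToDer F n).app (op X) ((satIso F n X).hom y) = satelliteToDer F n X y := by
  have h : (satIso F n X).hom ≫ (satToDer F n).app (op X) = satelliteToDer F n X :=
    (satIso F n X).hom_inv_id_assoc _
  exact ConcreteCategory.congr_hom h y

lemma compSyzToSat_apply (n : ℕ) (X : A) (x : (subStab F).obj (op (syzygy (syz n X)))) :
    (compSyzToSat F n).app (op X) x =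
      (satIso F n X).hom (toSatellite F (syz n X) ((subStabι F).app _ x)) := rfl

lemma compSyzToSat_satToDer (n : ℕ) : compSyzToSat F n ≫ satToDer F n = 0 := by
  ext X x
  exact (congrArg _ (compSyzToSat_apply F n X.unop x)).trans
    ((satToDer_satIso F n X.unop _).trans (satelliteToDer_subStabι F n X.unop x))

lemma satToDer_connecting (n : ℕ) : satToDer F n ≫ connecting F (n + 1) = 0 := by
  ext X y
  obtain ⟨y, rfl⟩ := satIso_surjective F n X.unop y
  exact (congrArg _ (satToDer_satIso F n X.unop y)).trans
    (derToSyz_satelliteToDer F n X.unop y)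

lemma connecting_compSyzToSat (n : ℕ) : connecting F n ≫ compSyzToSat F n = 0 := by
  ext X r
  exact (compSyzToSat_apply F n X.unop _).trans
    ((congrArg _ (toSatellite_derToSyz F n X.unop r)).trans (map_zero _))

lemma exactAt_subStabι_rho : ExactAt (subStabι F) (rho F) :=
  ⟨subStabι_rho F, ShortComplex.exact_kernel (rho F)⟩

lemma exactAt_compSyzToSat_satToDer (n : ℕ) : ExactAt (compSyzToSat F n) (satToDer F n) :=
  exactAt_of_app (compSyzToSat_satToDer F n) fun X y hy => by
    obtain ⟨y, rfl⟩ := satIso_surjective F n X.unop y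
    obtain ⟨x, hx⟩ := exists_subStab_eq_of_satelliteToDer_eq_zero F n X.unop y
      ((satToDer_satIso F n X.unop y).symm.trans hy)
    exact ⟨x, (compSyzToSat_apply F n X.unop x).trans (congrArg _ hx)⟩

lemma exactAt_connecting_compSyzToSat (n : ℕ) : ExactAt (connecting F n) (compSyzToSat F n) :=
  exactAt_of_app (connecting_compSyzToSat F n) fun X x hx =>
    exists_derToSyz_eq F n X.unop x (satIso_injective F n X.unop
      (((compSyzToSat_apply F n X.unop x).symm.trans hx).trans (map_zero _).symm))

lemma IsHalfExact.exactAt_rho_connecting {F : Aᵒᵖ ⥤ AddCommGrpCat.{w}} [F.Additive]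
    (hF : IsHalfExact F) : ExactAt (rho F) (connecting F 0) :=
  exactAt_of_app (rho_connecting F) fun X r hr =>
    exists_rho_eq_of_derToSyz_eq_zero hF X.unop r hr

lemma IsHalfExact.exactAt_satToDer_connecting {F : Aᵒᵖ ⥤ AddCommGrpCat.{w}} [F.Additive]
    (hF : IsHalfExact F) (n : ℕ) : ExactAt (satToDer F n) (connecting F (n + 1)) :=
  exactAt_of_app (satToDer_connecting F n) fun X r hr => by
    obtain ⟨y, hy⟩ := exists_satelliteToDer_eq hF n X.unop r hr
    exact ⟨(satIso F n X.unop).hom y, (satToDer_satIso F n X.unop y).trans hy⟩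

/-! ### Conditions on monomorphisms and epimorphisms; left-exactness -/

lemma epi_beta (hF : ∀ ⦃X Y : A⦄ (f : X ⟶ Y), Mono f → Epi (F.map f.op)) : Epi (beta F) := by
  rw [NatTrans.epi_iff_epi_app]
  intro X
  rw [AddCommGrpCat.epi_iff_surjective]
  intro x
  have := hF (syzι X.unop) inferInstance
  obtain ⟨z, hz⟩ := (AddCommGrpCat.epi_iff_surjective _).1 this ((subStabι F).app _ x)
  exact exists_derToSyz_eq_of_fromX F 0 X.unop x z hz

lemma isZero_subStab (hF : ∀ ⦃X Y : A⦄ (f : X ⟶ Y), Epi f → Mono (F.map f.op)) :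
    IsZero (subStab F) := by
  have h : subStabι F = 0 := by
    ext X x
    have := hF (Projective.π X.unop) inferInstance
    apply (AddCommGrpCat.mono_iff_injective _).1 this
    exact (map_π_subStabι F X.unop x).trans (map_zero _).symm
  rw [IsZero.iff_id_eq_zero, ← cancel_mono (subStabι F), h, comp_zero, comp_zero]

lemma mono_rho_of_isZero (h : IsZero (subStab F)) : Mono (rho F) :=
  Preadditive.mono_of_isZero_kernel _ h

lemma IsLeftExact.isIso_rho {F : Aᵒᵖ ⥤ AddCommGrpCat.{w}} [F.Additive] (hF : IsLeftExact F) :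
    IsIso (rho F) := by
  -- Every epimorphism f ends the right exact sequence ker f ⟶ X ⟶ Y ⟶ 0, so a left-exact F turns it
  -- into a monomorphism.
  have hmono : Mono (rho F) := mono_rho_of_isZero F (isZero_subStab F fun X Y f _ =>
    (hF (ShortComplex.mk (kernel.ι f) f (kernel.condition f)) (ShortComplex.exact_kernel f)
      ‹_›).2)
  have hepi : Epi (rho F) := by
    rw [NatTrans.epi_iff_epi_app]
    intro X
    rw [AddCommGrpCat.epi_iff_surjective]
    intro r
    obtain ⟨c, rfl⟩ := derClass_surjective F 0 X.unop r
    -- Left-exactness on P₁ ⟶ P₀ ⟶ X ⟶ 0: cocycles in F(P₀) come from F(X).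
    have h := (hF _ (exact_resD_π X.unop) (inferInstanceAs (Epi (Projective.π X.unop)))).1
    have hc := d_iCycles F 0 X.unop c
    rw [derComplex_d] at hc
    obtain ⟨x, hx⟩ := (ShortComplex.ab_exact_iff _).1 h _ hc
    exact ⟨x, rho_eq_derClass_of_map_π_eq F X.unop c x hx⟩
  exact isIso_of_mono_of_epi _

lemma map_π_injective_of_mono_rho [Mono (rho F)] (X : A) :
    Function.Injective (F.map (Projective.π X).op) := by
  rw [injective_iff_map_eq_zero]
  intro x hx
  have h : Function.Injective ((rho F).app (op X)) :=
    (AddCommGrpCat.mono_iff_injective _).1 inferInstance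
  exact h (((rho_eq_zero_iff F X x).2 hx).trans (map_zero _).symm)

lemma exists_map_π_eq_of_epi_rho [Epi (rho F)] (X : A) (z : F.obj (op (Projective.over X)))
    (hz : F.map (resD X).op z = 0) : ∃ x, F.map (Projective.π X).op x = z := by
  obtain ⟨c, rfl⟩ := exists_iCycles_eq F 0 X z (by rw [derComplex_d]; exact hz)
  have h : Function.Surjective ((rho F).app (op X)) :=
    (AddCommGrpCat.epi_iff_surjective _).1 inferInstance
  obtain ⟨x, hx⟩ := h (derClass F 0 X c)
  rw [rho_eq_derClass] at hx
  refine ⟨x, (iCycles_rhoCycle F X x).symm.trans ?_⟩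
  exact congrArg _ (derClass_zero_injective F X hx)

/-- If `y` vanishes along `X₁ ⟶ X₂`, it vanishes along every map from a projective to `X₂` that
is killed by `X₂ ⟶ X₃`. -/
lemma map_apply_eq_zero_of_exact {S : ShortComplex A} (hS : S.Exact) (y : F.obj (op S.X₂))
    (hy : F.map S.f.op y = 0) {P : A} [Projective P] (t : P ⟶ S.X₂) (ht : t ≫ S.g = 0) :
    F.map t.op y = 0 := by
  obtain ⟨k, hk⟩ : ∃ k : P ⟶ S.X₁, k ≫ S.f = t := ⟨_, hS.liftFromProjective_comp t ht⟩
  rw [← hk, ← map_map_apply, hy, map_zero]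

/-- Invertibility of ρ only concerns the chosen resolutions. The lift l of P(X₃) ⟶ X₃ to X₂ carries
elements of F(X₂) into F(P(X₃)), where that information applies. -/
lemma isLeftExact_of_isIso_rho [IsIso (rho F)] : IsLeftExact F := by
  intro S hS hg
  let l : Projective.over S.X₃ ⟶ S.X₂ := Projective.factorThru (Projective.π _) S.g
  have hl : l ≫ S.g = Projective.π _ := Projective.factorThru_comp _ _
  constructor
  · rw [ShortComplex.ab_exact_iff]
    intro y hy
    change F.obj (op S.X₂) at y
    replace hy : F.map S.f.op y = 0 := hy
    -- F(l)y is a cocycle: P₁ ⟶ P(X₃) ⟶ X₂ is killed by `S.g`, hence factors through X₁, where y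
    -- vanishes.
    obtain ⟨x, hx⟩ := exists_map_π_eq_of_epi_rho F S.X₃ (F.map l.op y) (by
      rw [map_map_apply]
      exact map_apply_eq_zero_of_exact F hS y hy _ (by rw [assoc, hl, resD_π]))
    refine ⟨x, map_π_injective_of_mono_rho F S.X₂ ?_⟩
    -- To prove F(g)x = y it suffices to compare in F(P(X₂)). The two maps P(X₂) ⟶ X₂, one through l
    -- and one the projection, agree after `S.g`, so y cannot distinguish them.
    have h := map_apply_eq_zero_of_exact F hS y hy
      (overMap S.g ≫ l - Projective.π S.X₂)
      (by rw [Preadditive.sub_comp, assoc, hl, overMap_π, sub_self])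
    have h' : F.map (overMap S.g ≫ l).op y = F.map (Projective.π S.X₂).op y := by
      rw [op_sub, F.map_sub] at h
      exact sub_eq_zero.1 h
    rw [← h', ← map_map_apply, ← hx, map_map_apply, overMap_π]
    exact map_map_apply F (Projective.π S.X₂) S.g x
  · rw [AddCommGrpCat.mono_iff_injective, injective_iff_map_eq_zero]
    intro x hx
    apply map_π_injective_of_mono_rho F S.X₃
    -- The projection onto X₃ factors through `S.g`, so F(g)x = 0 forces F(π)x = 0.
    rw [map_zero, ← hl, ← map_map_apply]
    exact (congrArg _ hx).trans (map_zero _)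

end FunctorSequence

end

end FundamentalSequence

theorem mainTheorem3 {A : Type u} [Category.{v} A] [Abelian A] [EnoughProjectives A]
    (F : Aᵒᵖ ⥤ AddCommGrpCat.{w}) [F.Additive] :
    -- the right fundamental sequence is a complex, exact except possibly at the terms `RₙF`
    ((∀ n, FundamentalSequence.rfsSubToSat F n ≫ FundamentalSequence.rfsSatToDer F n = 0) ∧
      (∀ n, FundamentalSequence.rfsSatToDer F n ≫ FundamentalSequence.rfsDerToSub F n = 0) ∧
      (∀ n, FundamentalSequence.rfsDerToSub F n ≫
        FundamentalSequence.rfsSubToSat F (n + 1) = 0) ∧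
      Mono (FundamentalSequence.rfsSubToSat F 0) ∧
      (∀ n, FundamentalSequence.ExactAt (FundamentalSequence.rfsSubToSat F n)
        (FundamentalSequence.rfsSatToDer F n)) ∧
      (∀ n, FundamentalSequence.ExactAt (FundamentalSequence.rfsDerToSub F n)
        (FundamentalSequence.rfsSubToSat F (n + 1)))) ∧
    -- if `F` is half-exact, the sequence is also exact at the terms `RₙF`
    (FundamentalSequence.IsHalfExact F →
      ∀ n, FundamentalSequence.ExactAt (FundamentalSequence.rfsSatToDer F n)
        (FundamentalSequence.rfsDerToSub F n)) ∧
    ((∀ ⦃X Y : A⦄ (f : X ⟶ Y), Mono f → Epi (F.map f.op)) →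
      Epi (FundamentalSequence.beta F)) ∧
    ((∀ ⦃X Y : A⦄ (f : X ⟶ Y), Epi f → Mono (F.map f.op)) →
      IsZero (FundamentalSequence.subStab F) ∧ Mono (FundamentalSequence.rho F)) ∧
    (IsIso (FundamentalSequence.rho F) ↔ FundamentalSequence.IsLeftExact F) := by
  refine ⟨⟨?_, ?_, fun n => FundamentalSequence.connecting_compSyzToSat F n,
    inferInstanceAs (Mono (FundamentalSequence.subStabι F)), ?_,
    fun n => FundamentalSequence.exactAt_connecting_compSyzToSat F n⟩,
    fun hF => ?_, FundamentalSequence.epi_beta F, fun hF => ?_,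
    fun _ => FundamentalSequence.isLeftExact_of_isIso_rho F, fun hF => hF.isIso_rho⟩
  · rintro (_ | n)
    · exact FundamentalSequence.subStabι_rho F
    · exact FundamentalSequence.compSyzToSat_satToDer F n
  · rintro (_ | n)
    · exact FundamentalSequence.rho_connecting F
    · exact FundamentalSequence.satToDer_connecting F n
  · rintro (_ | n)
    · exact FundamentalSequence.exactAt_subStabι_rho F
    · exact FundamentalSequence.exactAt_compSyzToSat_satToDer F n
  · rintro (_ | n)
    · exact hF.exactAt_rho_connecting
    · exact hF.exactAt_satToDer_connecting n
  · have h := FundamentalSequence.isZero_subStab F hF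
    exact ⟨h, FundamentalSequence.mono_rho_of_isZero F h⟩
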